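/- Theorem 4.5. Call an action of a countable group $G$ on a countable set $Y$ highly faithful if for every finite $F\subseteq G\setminus\{1\}$ there is $y\in Y$ with $fy\ne y$ for all $f\in F$; call a measure-preserving action of $G$ on a probability space highly faithful if for almost every $x$ the action of $G$ on the orbit $G\cdot x$ is highly faithful. Let $\Gamma$ be a countable group with a measure-preserving, ergodic, highly faithful action on a standard probability space $(X,\mu)$, and let $\Lambda$ be a residually finite countable group. Let $(F_n)_{n\in\mathbb N}$ be an increasing sequence of finite subsets of $\Gamma$ with $\bigcup_n F_n=\Gamma$ and $1\in F_0$, and let $(A_n)_{n\in\mathbb N}$ be Borel subsets of $X$ of positive measure such that the sets $fA_n$, for $n\in\mathbb N$ and $f\in F_n$, are pairwise disjoint (up to null sets). Put $U=\bigcup_{n\in\mathbb N}\bigcup_{f\in F_n} fA_n$. Let $(X_m,\alpha_m,o_m)_{m\in\mathbb N}$ be an asymptotically free sequence of actions of $\Lambda$ on finite pointed sets, i.e. for every $\lambda\in\Lambda\setminus\{1\}$ there is $N$ such that $\alpha_m(\lambda)o_m\neq o_m$ for all $m\ge N$. Then there is a measure-preserving $\Lambda$-action on $(X,\mu)$ which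 preserves the $\Gamma$-orbits (i.e. $\lambda x\in\Gamma\cdot x$ for all $\lambda\in\Lambda$, $x\in X$) such that: 1. the induced action of the free product $\Gamma*\Lambda$ is highly faithful; 2. the $\Lambda$-action is supported on $U$ (every point outside $U$ is fixed by $\Lambda$) and has only finite orbits; 3. for every $x\in X$, either $x$ is fixed by $\Lambda$, or there is $n\in\mathbb N$ such that the $\Lambda$-action on $\Lambda\cdot x$ is conjugate to the restriction of $\alpha_n$ to the $\alpha_n$-orbit of $o_n$ (thus to $\alpha_n$ itself if $\alpha_n$ is transitive); 4. for every measure-preserving $\Lambda$-action on $(X,\mu)$ that coincides with this action at almost every point of $U$, the induced $\Gamma*\Lambda$-action is highly faithful. -/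

import Mathlib

open MeasureTheory
open scoped Pointwise Monoid.Coprod

/-- The action of `G` on the points of an invariant set `Y`, given by `ρ : G →* Equiv.Perm X`, is
highly faithful: every finite set of nontrivial group elements has a point of `Y` that is moved
by all of them. -/
def HighlyFaithfulOn {G X : Type*} [Group G] (ρ : G →* Equiv.Perm X) (Y : Set X) : Prop :=
  ∀ F : Finset G, (1 : G) ∉ F → ∃ y ∈ Y, ∀ f ∈ F, ρ f y ≠ y

/-- The orbit of `x` under the action `ρ`. -/
def orbitOf {G X : Type*} [Group G] (ρ : G →* Equiv.Perm X) (x : X) : Set X :=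
  Set.range fun g : G => ρ g x

/-- An action on a measure space is highly faithful if it is highly faithful on almost every
orbit. -/
def AEHighlyFaithful {G X : Type*} [Group G] [MeasurableSpace X] (ρ : G →* Equiv.Perm X)
    (μ : Measure X) : Prop :=
  ∀ᵐ x ∂μ, HighlyFaithfulOn ρ (orbitOf ρ x)

/-- Every group element acts by a measurable, measure-preserving bijection. -/
def IsPMPAction {G X : Type*} [Group G] [MeasurableSpace X] (ρ : G →* Equiv.Perm X)
    (μ : Measure X) : Prop :=
  ∀ g : G, MeasurePreserving (ρ g) μ μ

/-- A sequence of pointed actions `(Y m, o m)` is asymptotically free: every nontrivial element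
moves the base point `o m` for all large `m`. -/
def AsymptoticallyFree (G : Type*) [Group G] {Y : ℕ → Type*} [∀ m, MulAction G (Y m)]
    (o : ∀ m, Y m) : Prop :=
  ∀ g : G, g ≠ 1 → ∃ N : ℕ, ∀ m ≥ N, g • o m ≠ o m

/-- The action `ρ` restricted to the orbit of `x` is conjugate, by an equivariant bijection, to
the given action on the orbit of the point `p`. If the action on `Z` is transitive, the latter is
all of `Z`. -/
def OrbitConjugate {G X Z : Type*} [Group G] [MulAction G Z] (ρ : G →* Equiv.Perm X) (x : X)
    (p : Z) : Prop :=
  ∃ e : MulAction.orbit G p ≃ orbitOf ρ x,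
    ∀ (g : G) (z : MulAction.orbit G p), (e (g • z) : X) = ρ g (e z : X)

/-- The action of the free product `G ∗ H` induced by an action of `G` and an action of `H`. -/
def inducedAction {G H X : Type*} [Group G] [Group H] (ρ : G →* Equiv.Perm X)
    (β : H →* Equiv.Perm X) : G ∗ H →* Equiv.Perm X :=
  Monoid.Coprod.lift ρ β

/-- The union of the translates `f • A n` with `f ∈ F n` and `n : ℕ`. -/
def translatesUnion {G X : Type*} [Group G] [MulAction G X] (F : ℕ → Finset G) (A : ℕ → Set X) :
    Set X :=
  ⋃ n : ℕ, ⋃ f ∈ F n, f • A n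

/-! The free product `Γ ∗ Λ` acts on alternating words with letters in `Γ` and in a pointed `Λ`-set,
the base points being dropped. By ping-pong, a finite set `E` of nontrivial elements moves the empty
word once the base point is moved by all `Λ`-letters that occur in `E`
(`exists_inducedAction_nil_ne`). Only finitely many words matter for this, so a finite `Λ`-invariant
set of words is copied into `X` (`exists_translates_model`): the word with `Γ`-letter `g` and tail
`s` goes to `g * γ s` applied to a set `B`, where ergodicity provides `γ s` carrying `B` into a
chosen `A n` with `g ∈ F n`.

Distinct words land in distinct sets `g • A n`, and different `E` use disjoint sets of indices `n`,
so all copies coexist in one piecewise action (`exists_piecewise_action`). Almost every `Γ`-orbit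
meets every `B`, hence contains a point moved by all of `E`, for every `E`. -/

/-! ### Ergodicity: recurrence to sets of positive measure -/

section Ergodic

variable {X : Type*} [MeasurableSpace X] {μ : Measure X}
  {Γ : Type*} [Group Γ] [Countable Γ] [MulAction Γ X] [MeasurableConstSMul Γ X] [ErgodicSMul Γ X μ]

/-- Almost every orbit of an ergodic action meets a given set of positive measure. -/
theorem ae_exists_smul_mem (B : Set X) (hB : MeasurableSet B) (hpos : 0 < μ B) :
    ∀ᵐ x ∂μ, ∃ γ : Γ, γ • x ∈ B := by
  set s : Set X := ⋃ γ : Γ, (γ • ·) ⁻¹' B with hs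
  have hsm : MeasurableSet s := .iUnion fun γ => measurable_const_smul γ hB
  have hinv : ∀ g : Γ, (g • ·) ⁻¹' s = s := by
    intro g
    ext x
    simp only [hs, Set.mem_preimage, Set.mem_iUnion]
    exact ⟨fun ⟨γ, h⟩ => ⟨γ * g, by rwa [mul_smul]⟩,
      fun ⟨γ, h⟩ => ⟨γ * g⁻¹, by rwa [mul_smul, inv_smul_smul]⟩⟩
  have hc := aeconst_of_forall_preimage_smul_ae_eq Γ (μ := μ) hsm.nullMeasurableSet
    fun g => Filter.EventuallyEq.of_eq (hinv g)
  rcases Filter.eventuallyConst_set.1 hc with h | h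
  · filter_upwards [h] with x hx
    simpa [hs] using hx
  · have h0 : ∀ᵐ x ∂μ, x ∉ B := by
      filter_upwards [h] with x hx hxB
      exact hx (Set.mem_iUnion.2 ⟨1, by simpa using hxB⟩)
    rw [ae_iff] at h0
    simp only [not_not, Set.ofPred_mem_eq] at h0
    exact absurd h0 hpos.ne'

/-- Finitely many sets of positive measure have translates with a common part of positive
measure. -/
theorem exists_smul_mem_of_finset {ι : Type*} (s : Finset ι) (A : ι → Set X)
    (hA : ∀ i, MeasurableSet (A i)) (hpos : ∀ i, 0 < μ (A i)) (huniv : 0 < μ Set.univ) :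
    ∃ (γ : ι → Γ) (B : Set X), MeasurableSet B ∧ 0 < μ B ∧ ∀ i ∈ s, ∀ b ∈ B, γ i • b ∈ A i := by
  classical
  induction s using Finset.induction_on with
  | empty => exact ⟨fun _ => 1, Set.univ, .univ, huniv, by simp⟩
  | insert i s hi ih =>
    obtain ⟨γ, B, hBm, hBpos, hB⟩ := ih
    -- Otherwise almost no point of `B` has an orbit meeting `A i`, so `B` would be null.
    have hex : ∃ g : Γ, μ (B ∩ (g • ·) ⁻¹' A i) ≠ 0 := by
      by_contra! h0
      have h1 : ∀ᵐ x ∂μ, ∀ g : Γ, ¬ (x ∈ B ∧ g • x ∈ A i) := by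
        rw [ae_all_iff]
        intro g
        rw [ae_iff]
        simpa [Set.inter_def] using h0 g
      have h2 : ∀ᵐ x ∂μ, x ∉ B := by
        filter_upwards [h1, ae_exists_smul_mem (Γ := Γ) (A i) (hA i) (hpos i)] with x hx hx' hxB
        obtain ⟨g, hg⟩ := hx'
        exact hx g ⟨hxB, hg⟩
      rw [ae_iff] at h2
      simp only [not_not, Set.ofPred_mem_eq] at h2
      exact hBpos.ne' h2
    obtain ⟨g, hg⟩ := hex
    refine ⟨Function.update γ i g, _, hBm.inter (measurable_const_smul g (hA i)),
      pos_iff_ne_zero.2 hg, ?_⟩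
    intro j hj b hb
    rcases eq_or_ne j i with rfl | hji
    · simpa using hb.2
    · rw [Function.update_of_ne hji]
      exact hB j ((Finset.mem_insert.1 hj).resolve_left hji) b hb.1

end Ergodic

/-! ### Actions that permute disjoint translates -/

section PiecewiseAction

variable {X : Type*} [MeasurableSpace X] (μ : Measure X)
  {Γ : Type*} [Group Γ] [MulAction Γ X] [MeasurableConstSMul Γ X] [SMulInvariantMeasure Γ X μ]
  {Λ : Type*} [Group Λ]

/-- A countable `Λ`-set `P` that labels pairwise disjoint pieces `δ p • B p`, with `B` constant on
the orbits of `P`, gives rise to a measure-preserving action of `Λ` that permutes the pieces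
through `Γ`, and fixes the other points. -/
theorem exists_piecewise_action {P : Type*} [Countable P] [MulAction Λ P] (δ : P → Γ)
    (B : P → Set X) (hB : ∀ p, MeasurableSet (B p)) (hinv : ∀ (l : Λ) p, B (l • p) = B p)
    (hdisj : ∀ p q x, x ∈ δ p • B p → x ∈ δ q • B q → p = q) :
    ∃ β : Λ →* Equiv.Perm X, IsPMPAction β μ ∧
      (∀ (l : Λ) (x : X), β l x ∈ MulAction.orbit Γ x) ∧
      (∀ (l : Λ) (p : P), ∀ b ∈ B p, β l (δ p • b) = δ (l • p) • b) ∧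
      ∀ x, (∀ p, x ∉ δ p • B p) → ∀ l, β l x = x := by
  classical
  -- By `hdisj` a point lies in at most one piece, so the choice of label is forced.
  let f : Λ → X → X := fun l x =>
    if h : ∃ p, x ∈ δ p • B p then (δ (l • h.choose) * (δ h.choose)⁻¹) • x else x
  have f_smul : ∀ l p, ∀ b ∈ B p, f l (δ p • b) = δ (l • p) • b := by
    intro l p b hb
    have h : ∃ q, δ p • b ∈ δ q • B q := ⟨p, Set.smul_mem_smul_set hb⟩
    have hp : h.choose = p := hdisj _ _ _ h.choose_spec (Set.smul_mem_smul_set hb)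
    simp only [f, dif_pos h, hp]
    rw [mul_smul, inv_smul_smul]
  have f_fix : ∀ x, (∀ p, x ∉ δ p • B p) → ∀ l, f l x = x := by
    intro x hx l
    have h : ¬ ∃ p, x ∈ δ p • B p := by simpa using hx
    simp only [f, dif_neg h]
  have cases_x : ∀ x, (∃ p, ∃ b ∈ B p, x = δ p • b) ∨ ∀ p, x ∉ δ p • B p := by
    intro x
    by_cases h : ∃ p, x ∈ δ p • B p
    · obtain ⟨p, b, hb, rfl⟩ := h
      exact Or.inl ⟨p, b, hb, rfl⟩
    · exact Or.inr (by simpa using h)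
  let φ : Λ →* Function.End X :=
    { toFun := f
      map_one' := by
        funext x
        rcases cases_x x with ⟨p, b, hb, rfl⟩ | h
        · rw [f_smul _ _ _ hb, one_smul]; rfl
        · exact f_fix x h 1
      map_mul' := by
        intro l m
        funext x
        change f (l * m) x = f l (f m x)
        rcases cases_x x with ⟨p, b, hb, rfl⟩ | h
        · rw [f_smul _ _ _ hb, f_smul _ _ _ hb, f_smul _ _ _ (by rwa [hinv]), mul_smul]
        · rw [f_fix x h, f_fix x h, f_fix x h] }
  have hC : ∀ p, MeasurableSet (δ p • B p) := fun p => (hB p).const_smul _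
  let R : Set X := (⋃ p, δ p • B p)ᶜ
  have hR : MeasurableSet R := (MeasurableSet.iUnion hC).compl
  have hpre : ∀ l E, f l ⁻¹' E = (⋃ p, ((δ (l • p) * (δ p)⁻¹) • ·) ⁻¹' (E ∩ δ (l • p) • B (l • p)))
      ∪ (E ∩ R) := by
    intro l E
    ext x
    simp only [Set.mem_preimage, Set.mem_union, Set.mem_iUnion, Set.mem_inter_iff, R,
      Set.mem_compl_iff, not_exists]
    have key : ∀ p, (δ (l • p) * (δ p)⁻¹) • x ∈ δ (l • p) • B (l • p) ↔ x ∈ δ p • B p := by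
      intro p
      rw [hinv, Set.mem_smul_set_iff_inv_smul_mem, Set.mem_smul_set_iff_inv_smul_mem, mul_smul,
        inv_smul_smul]
    simp only [key]
    rcases cases_x x with ⟨p, b, hb, rfl⟩ | h
    · have hmem : δ p • b ∈ δ p • B p := Set.smul_mem_smul_set hb
      rw [f_smul _ _ _ hb]
      constructor
      · exact fun h => Or.inl ⟨p, by rwa [mul_smul, inv_smul_smul], hmem⟩
      · rintro (⟨q, hq, hq'⟩ | ⟨_, h⟩)
        · obtain rfl := hdisj _ _ _ hmem hq'
          rwa [mul_smul, inv_smul_smul] at hq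
        · exact absurd hmem (h p)
    · rw [f_fix x h]
      exact ⟨fun hx => Or.inr ⟨hx, h⟩, fun hx => hx.elim (fun ⟨p, _, hp⟩ => absurd hp (h p)) And.left⟩
  have hmp : ∀ l, MeasurePreserving (f l) μ μ := by
    intro l
    have hmeas : Measurable (f l) := by
      intro E hE
      rw [hpre]
      exact (MeasurableSet.iUnion fun p =>
        measurable_const_smul _ (hE.inter (hC _))).union (hE.inter hR)
    refine ⟨hmeas, Measure.ext fun E hE => ?_⟩
    have hEC : ∀ p, MeasurableSet (E ∩ δ p • B p) := fun p => hE.inter (hC p)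
    have hpieces : ∀ p, ((δ (l • p) * (δ p)⁻¹) • ·) ⁻¹' (E ∩ δ (l • p) • B (l • p)) ⊆
        δ p • B p := by
      intro p x hx
      have h := hx.2
      change (δ (l • p) * (δ p)⁻¹) • x ∈ _ at h
      rwa [hinv, Set.mem_smul_set_iff_inv_smul_mem, mul_smul, inv_smul_smul,
        ← Set.mem_smul_set_iff_inv_smul_mem] at h
    have hdC : Pairwise (Function.onFun Disjoint fun p => δ p • B p) := fun p q hpq =>
      Set.disjoint_left.2 fun x hx hx' => hpq (hdisj p q x hx hx')
    rw [Measure.map_apply hmeas hE, hpre, measure_union _ (hE.inter hR), measure_iUnion]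
    · have hE' : μ E = μ ((⋃ p, E ∩ δ p • B p) ∪ (E ∩ R)) := by
        rw [← Set.inter_iUnion, ← Set.inter_union_distrib_left, Set.union_compl_self,
          Set.inter_univ]
      rw [hE', measure_union _ (hE.inter hR), measure_iUnion _ hEC]
      · congr 1
        -- Since `l` permutes the labels, the sum over target pieces becomes a sum over source
        -- pieces; each term is then preserved because a single element of `Γ` acts there.
        rw [← (MulAction.toPerm l : Equiv.Perm P).tsum_eq fun p => μ (E ∩ δ p • B p)]
        exact tsum_congr fun p => measure_preimage_smul_of_nullMeasurableSet
          (hEC _).nullMeasurableSet _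
      · exact fun p q hpq => (hdC hpq).mono Set.inter_subset_right Set.inter_subset_right
      · rw [← Set.inter_iUnion]
        exact disjoint_compl_right.mono Set.inter_subset_right Set.inter_subset_right
    · exact fun p q hpq => (hdC hpq).mono (hpieces p) (hpieces q)
    · exact fun p => measurable_const_smul _ (hEC _)
    · exact disjoint_compl_right.mono (Set.iUnion_mono hpieces) Set.inter_subset_right
  refine ⟨φ.toHomPerm, hmp, ?_, f_smul, f_fix⟩
  intro l x
  change f l x ∈ _
  rcases cases_x x with ⟨p, b, hb, rfl⟩ | h
  · rw [f_smul _ _ _ hb]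
    exact ⟨δ (l • p) * (δ p)⁻¹, by simp [mul_smul]⟩
  · rw [f_fix x h]
    exact MulAction.mem_orbit_self x

end PiecewiseAction

/-! ### Alternating words and their two decompositions -/

section AlternatingWords

/-- Alternating words in two pointed sets `(M, a₀)` and `(N, b₀)`, without the letters `a₀` and
`b₀`. Nonempty words start with a letter in `M` if the index is `true`, and with a letter in `N` if
the index is `false`. -/
inductive AlternatingWord {M N : Type*} (a₀ : M) (b₀ : N) : Bool → Type _
  | nil (i : Bool) : AlternatingWord a₀ b₀ i
  | consLeft (a : M) (ha : a ≠ a₀) (t : AlternatingWord a₀ b₀ false) : AlternatingWord a₀ b₀ true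
  | consRight (b : N) (hb : b ≠ b₀) (t : AlternatingWord a₀ b₀ true) : AlternatingWord a₀ b₀ false

namespace AlternatingWord

variable {M N : Type*} {a₀ : M} {b₀ : N}

open Classical in
/-- Splits off the initial letter in `N` (or `b₀`) of the word obtained by putting a letter in `M`
in front of a word. -/
noncomputable def toRight : M × AlternatingWord a₀ b₀ false → N × AlternatingWord a₀ b₀ true
  | (a, t) => if h : a = a₀ then
      match t with
      | .nil _ => (b₀, .nil _)
      | .consRight b _ s => (b, s)
    else (b₀, .consLeft a h t)

open Classical in
/-- Splits off the initial letter in `M` (or `a₀`) of the word obtained by putting a letter in `N`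
in front of a word. -/
noncomputable def toLeft : N × AlternatingWord a₀ b₀ true → M × AlternatingWord a₀ b₀ false
  | (b, t) => if h : b = b₀ then
      match t with
      | .nil _ => (a₀, .nil _)
      | .consLeft a _ s => (a, s)
    else (a₀, .consRight b h t)

/-- Each alternating word is determined by its initial letter on either side and the rest. -/
noncomputable def splitEquiv :
    M × AlternatingWord a₀ b₀ false ≃ N × AlternatingWord a₀ b₀ true where
  toFun := toRight
  invFun := toLeft
  left_inv := by
    rintro ⟨a, t⟩
    by_cases h : a = a₀
    · subst h
      cases t with
      | nil => simp [toRight, toLeft]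
      | consRight b hb s => simp [toRight, toLeft, hb]
    · simp [toRight, toLeft, h]
  right_inv := by
    rintro ⟨b, t⟩
    by_cases h : b = b₀
    · subst h
      cases t with
      | nil => simp [toRight, toLeft]
      | consLeft a ha s => simp [toRight, toLeft, ha]
    · simp [toRight, toLeft, h]

theorem splitEquiv_nil : splitEquiv (a₀, nil (a₀ := a₀) (b₀ := b₀) false) = (b₀, nil true) := by
  simp [splitEquiv, toRight]

theorem splitEquiv_fst_of_ne (z : M × AlternatingWord a₀ b₀ false) (h : z.1 ≠ a₀) :
    (splitEquiv z).1 = b₀ := by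
  obtain ⟨a, t⟩ := z
  simp only [ne_eq] at h
  simp [splitEquiv, toRight, h]

end AlternatingWord

end AlternatingWords

/-! ### Free products acting on alternating words -/

section FreeProduct

variable {G H : Type*} [Group G] [Group H]

/-- `Monoid.Coprod.IsReduced i g`: the element `g` of `G ∗ H` is a nonempty product of nontrivial
letters, alternately in `G` and `H`, the first one in `G` if `i` is `true` and in `H` if `i` is
`false`. -/
inductive Monoid.Coprod.IsReduced : Bool → G ∗ H → Prop
  | singleLeft (a : G) (ha : a ≠ 1) : IsReduced true (.inl a)
  | singleRight (b : H) (hb : b ≠ 1) : IsReduced false (.inr b)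
  | mulLeft (a : G) (ha : a ≠ 1) (w : G ∗ H) (hw : IsReduced false w) : IsReduced true (.inl a * w)
  | mulRight (b : H) (hb : b ≠ 1) (w : G ∗ H) (hw : IsReduced true w) :
      IsReduced false (.inr b * w)

namespace Monoid.Coprod

theorem IsReduced.inl_mul {i : Bool} {w : G ∗ H} (hw : IsReduced i w) (a : G) :
    inl a * w = 1 ∨ ∃ j, IsReduced j (inl a * w) := by
  by_cases ha : a = 1
  · subst ha
    exact Or.inr ⟨i, by simpa using hw⟩
  cases hw with
  | singleLeft c hc =>
    rw [← map_mul]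
    by_cases h : a * c = 1
    · exact Or.inl (by rw [h, map_one])
    · exact Or.inr ⟨_, .singleLeft _ h⟩
  | singleRight b hb => exact Or.inr ⟨_, .mulLeft a ha _ (.singleRight b hb)⟩
  | mulLeft c hc w hw =>
    rw [← mul_assoc, ← map_mul]
    by_cases h : a * c = 1
    · exact Or.inr ⟨_, by simpa [h] using hw⟩
    · exact Or.inr ⟨_, .mulLeft _ h _ hw⟩
  | mulRight b hb w hw => exact Or.inr ⟨_, .mulLeft a ha _ (.mulRight b hb w hw)⟩

theorem IsReduced.inr_mul {i : Bool} {w : G ∗ H} (hw : IsReduced i w) (b : H) :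
    inr b * w = 1 ∨ ∃ j, IsReduced j (inr b * w) := by
  by_cases hb : b = 1
  · subst hb
    exact Or.inr ⟨i, by simpa using hw⟩
  cases hw with
  | singleRight c hc =>
    rw [← map_mul]
    by_cases h : b * c = 1
    · exact Or.inl (by rw [h, map_one])
    · exact Or.inr ⟨_, .singleRight _ h⟩
  | singleLeft a ha => exact Or.inr ⟨_, .mulRight b hb _ (.singleLeft a ha)⟩
  | mulRight c hc w hw =>
    rw [← mul_assoc, ← map_mul]
    by_cases h : b * c = 1
    · exact Or.inr ⟨_, by simpa [h] using hw⟩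
    · exact Or.inr ⟨_, .mulRight _ h _ hw⟩
  | mulLeft a ha w hw => exact Or.inr ⟨_, .mulRight b hb _ (.mulLeft a ha w hw)⟩

/-- Left multiplication by one letter lengthens a reduced word, merges with its first letter or
cancels it. Uniqueness of the reduced form is not needed for ping-pong. -/
theorem exists_isReduced (g : G ∗ H) : g = 1 ∨ ∃ i, IsReduced i g := by
  induction g using induction_on' with
  | one => exact Or.inl rfl
  | inl_mul a w ih =>
    rcases ih with rfl | ⟨i, hw⟩
    · by_cases ha : a = 1
      · exact Or.inl (by simp [ha])
      · exact Or.inr ⟨true, by simpa using .singleLeft a ha⟩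
    · exact hw.inl_mul a
  | inr_mul b w ih =>
    rcases ih with rfl | ⟨i, hw⟩
    · by_cases hb : b = 1
      · exact Or.inl (by simp [hb])
      · exact Or.inr ⟨false, by simpa using .singleRight b hb⟩
    · exact hw.inr_mul b

instance [Countable G] [Countable H] : Countable (G ∗ H) :=
  have : Countable (FreeMonoid (G ⊕ H)) := inferInstanceAs (Countable (List (G ⊕ H)))
  mk_surjective.countable

end Monoid.Coprod

/-- Trajectories of single points under `G ∗ H` use only finitely many instances of
equivariance under `H`. -/
theorem exists_finset_equivariant {Z X : Type*} (ρZ : G →* Equiv.Perm Z) (βZ : H →* Equiv.Perm Z)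
    (g : G ∗ H) (z : Z) : ∃ Q : Finset Z, ∀ (ρ : G →* Equiv.Perm X) (β : H →* Equiv.Perm X)
      (Φ : Z → X), (∀ a w, Φ (ρZ a w) = ρ a (Φ w)) → (∀ b, ∀ w ∈ Q, Φ (βZ b w) = β b (Φ w)) →
      Φ (inducedAction ρZ βZ g z) = inducedAction ρ β g (Φ z) := by
  classical
  induction g using Monoid.Coprod.induction_on generalizing z with
  | inl a => exact ⟨∅, fun ρ β Φ h _ => by simpa [inducedAction] using h a z⟩
  | inr b => exact ⟨{z}, fun ρ β Φ _ h => by simpa [inducedAction] using h b z (by simp)⟩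
  | mul g h ihg ihh =>
    obtain ⟨Q, hQ⟩ := ihh z
    obtain ⟨Q', hQ'⟩ := ihg (inducedAction ρZ βZ h z)
    refine ⟨Q ∪ Q', fun ρ β Φ h₁ h₂ => ?_⟩
    rw [map_mul, map_mul, Equiv.Perm.mul_apply, Equiv.Perm.mul_apply,
      hQ' ρ β Φ h₁ fun b w hw => h₂ b w (Finset.mem_union_right _ hw),
      hQ ρ β Φ h₁ fun b w hw => h₂ b w (Finset.mem_union_left _ hw)]

/-- A group acts on a product through its first factor. -/
def prodFstPerm {M : Type*} [MulAction G M] (S : Type*) : G →* Equiv.Perm (M × S) where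
  toFun g := (MulAction.toPerm g).prodCongr (Equiv.refl S)
  map_one' := by ext x <;> simp
  map_mul' g h := by ext x <;> simp [mul_smul]

/-- The action of `G` on alternating words in `G` and a pointed `H`-set. -/
def leftWordAction (G : Type*) [Group G] {N : Type*} (b₀ : N) :
    G →* Equiv.Perm (G × AlternatingWord (1 : G) b₀ false) :=
  prodFstPerm _

/-- The action of `H` on alternating words in `G` and a pointed `H`-set. -/
noncomputable def rightWordAction (G H : Type*) [Group G] [Group H] {N : Type*} [MulAction H N]
    (b₀ : N) : H →* Equiv.Perm (G × AlternatingWord (1 : G) b₀ false) :=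
  (AlternatingWord.splitEquiv.symm.permCongrHom.toMonoidHom).comp (prodFstPerm _)

theorem splitEquiv_rightWordAction {N : Type*} [MulAction H N] (b₀ : N) (b : H)
    (z : G × AlternatingWord (1 : G) b₀ false) :
    AlternatingWord.splitEquiv (rightWordAction G H b₀ b z) =
      (b • (AlternatingWord.splitEquiv z).1, (AlternatingWord.splitEquiv z).2) := by
  simp [rightWordAction, prodFstPerm, Prod.map]

/-- Nontrivial elements of `G ∗ H` eventually move the empty word, for an asymptotically free
sequence of pointed `H`-sets. -/
theorem exists_inducedAction_nil_ne {N : ℕ → Type*} [∀ m, MulAction H (N m)] (o : ∀ m, N m)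
    (ho : AsymptoticallyFree H o) (g : G ∗ H) (hg : g ≠ 1) :
    ∃ n, ∀ m ≥ n, inducedAction (leftWordAction G (o m)) (rightWordAction G H (o m)) g
      (1, .nil _) ≠ (1, .nil _) := by
  -- Ping-pong: the image of the empty word starts with a nontrivial letter on the same side as `g`.
  -- Seen from the other side its letter is then trivial, so the next letter of the group element
  -- moves it off the base point.
  have key : ∀ (i : Bool) (g : G ∗ H), Monoid.Coprod.IsReduced i g → ∃ n, ∀ m ≥ n,
      match i with
      | true => (inducedAction (leftWordAction G (o m)) (rightWordAction G H (o m)) g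
          (1, .nil _)).1 ≠ 1
      | false => (AlternatingWord.splitEquiv (inducedAction (leftWordAction G (o m))
          (rightWordAction G H (o m)) g (1, .nil _))).1 ≠ o m := by
    intro i g h
    induction h with
    | singleLeft a ha =>
      exact ⟨0, fun m _ => by simpa [inducedAction, leftWordAction, prodFstPerm] using ha⟩
    | singleRight b hb =>
      obtain ⟨n, hn⟩ := ho b hb
      refine ⟨n, fun m hm => ?_⟩
      simpa [inducedAction, splitEquiv_rightWordAction, AlternatingWord.splitEquiv_nil]
        using hn m hm
    | mulLeft a ha w _ ih =>
      obtain ⟨n, hn⟩ := ih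
      refine ⟨n, fun m hm => ?_⟩
      have h1 := not_imp_comm.1 (AlternatingWord.splitEquiv_fst_of_ne _) (hn m hm)
      simp only [inducedAction, leftWordAction, prodFstPerm] at h1
      simpa [inducedAction, leftWordAction, prodFstPerm, h1] using ha
    | mulRight b hb w _ ih =>
      obtain ⟨n, hn⟩ := ih
      obtain ⟨n', hn'⟩ := ho b hb
      refine ⟨max n n', fun m hm => ?_⟩
      have h1 := AlternatingWord.splitEquiv_fst_of_ne _ (hn m (le_of_max_le_left hm))
      have h2 := hn' m (le_of_max_le_right hm)
      simp only [inducedAction] at h1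
      simpa [inducedAction, splitEquiv_rightWordAction, h1] using h2
  obtain ⟨i, hi⟩ := (Monoid.Coprod.exists_isReduced g).resolve_left hg
  obtain ⟨n, hn⟩ := key i g hi
  refine ⟨n, fun m hm heq => ?_⟩
  have := hn m hm
  cases i
  · simp [heq, AlternatingWord.splitEquiv_nil] at this
  · simp [heq] at this

end FreeProduct

/-! ### Copying finitely many words into the space -/

/-- A finite part of the action of `Γ ∗ Λ` on alternating words, which contains the trajectories of
the empty word under a finite set `E` of nontrivial elements, can be modelled by translates of a set
`B` of positive measure. The translates lie in sets of the family `A` whose indices are paired with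
a prescribed number `k`. -/
theorem exists_translates_model
    {X : Type*} [MeasurableSpace X] (μ : Measure X) (huniv : 0 < μ Set.univ)
    {Γ : Type*} [Group Γ] [Countable Γ]
    [MulAction Γ X] [MeasurableConstSMul Γ X] [ErgodicSMul Γ X μ]
    {Λ : Type*} [Group Λ]
    (F : ℕ → Finset Γ) (hF_mono : Monotone F) (hF_exh : ∀ γ : Γ, ∃ n, γ ∈ F n)
    (A : ℕ → Set X) (hA_meas : ∀ n, MeasurableSet (A n)) (hA_pos : ∀ n, 0 < μ (A n))
    {N : ℕ → Type*} [∀ m, Finite (N m)] [∀ m, MulAction Λ (N m)] (o : ∀ m, N m)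
    (ho : AsymptoticallyFree Λ o) (k : ℕ) (E : Finset (Γ ∗ Λ)) (hE : 1 ∉ E) :
    ∃ (m c : ℕ) (δ : Fin c → N m → Γ) (ix : Fin c → N m → ℕ × Γ) (B : Set X),
      MeasurableSet B ∧ 0 < μ B ∧
      (∀ i w, (ix i w).1.unpair.1 = k ∧ (ix i w).2 ∈ F (ix i w).1 ∧
        ∀ b ∈ B, δ i w • b ∈ (ix i w).2 • A (ix i w).1) ∧
      (∀ i w i' w', ix i w = ix i' w' → i = i' ∧ w = w') ∧
      ∀ (β : Λ →* Equiv.Perm X) (b : X),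
        (∀ l i w, β l (δ i w • b) = δ i (l • w) • b) →
        (∀ i w i' w', δ i w • b = δ i' w' • b → i = i' ∧ w = w') →
        ∃ γ : Γ, ∀ f ∈ E,
          inducedAction (MulAction.toPermHom Γ X) β f (γ • b) ≠ γ • b := by
  classical
  obtain ⟨m, hm⟩ : ∃ m, ∀ g ∈ E, inducedAction (leftWordAction Γ (o m))
      (rightWordAction Γ Λ (o m)) g (1, .nil _) ≠ (1, .nil _) := by
    choose! n hn using exists_inducedAction_nil_ne (G := Γ) o ho
    exact ⟨E.sup n, fun g hg => hn g (fun h => hE (h ▸ hg)) _ (Finset.le_sup hg)⟩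
  have := Fintype.ofFinite (N m)
  set e := AlternatingWord.splitEquiv (a₀ := (1 : Γ)) (b₀ := o m) with he
  set z₀ : Γ × AlternatingWord (1 : Γ) (o m) false := (1, .nil _) with hz₀
  choose Q hQ using fun g => exists_finset_equivariant (X := X) (leftWordAction Γ (o m))
    (rightWordAction Γ Λ (o m)) g z₀
  set V : Finset (Γ × AlternatingWord (1 : Γ) (o m) false) := insert z₀ (E.biUnion fun g =>
    insert (inducedAction (leftWordAction Γ (o m)) (rightWordAction Γ Λ (o m)) g z₀) (Q g)) with hV
  -- Saturation of `V` under `Λ`: all words whose tail after the `Λ`-side letter occurs in `V`. They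
  -- form finitely many copies of the finite set `N m`.
  set T := V.image fun z => (e z).2 with hT
  let ζ : Fin T.card → N m → Γ × AlternatingWord (1 : Γ) (o m) false :=
    fun i w => e.symm (w, (T.equivFin.symm i : _))
  have ζ_inj : ∀ i w i' w', ζ i w = ζ i' w' → i = i' ∧ w = w' := by
    intro i w i' w' h
    have h' := e.symm.injective h
    simp only [Prod.mk.injEq, SetLike.coe_eq_coe, EmbeddingLike.apply_eq_iff_eq] at h'
    exact h'.symm
  have ζ_surj : ∀ z ∈ V, ∃ i w, ζ i w = z := by
    intro z hz
    refine ⟨T.equivFin ⟨(e z).2, Finset.mem_image_of_mem _ hz⟩, (e z).1, ?_⟩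
    simp [ζ]
  have ζ_smul : ∀ l i w, rightWordAction Γ Λ (o m) l (ζ i w) = ζ i (l • w) := by
    intro l i w
    apply e.injective
    rw [he, splitEquiv_rightWordAction, ← he]
    simp [ζ]
  obtain ⟨n₀, hn₀⟩ : ∃ n, ∀ i w, (ζ i w).1 ∈ F n := by
    choose n hn using hF_exh
    refine ⟨Finset.univ.sup fun p : Fin T.card × N m => n (ζ p.1 p.2).1, fun i w => ?_⟩
    exact hF_mono (Finset.le_sup (f := fun p : Fin T.card × N m => n (ζ p.1 p.2).1)
      (Finset.mem_univ (i, w))) (hn _)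
  set S := (Finset.univ : Finset (Fin T.card × N m)).image fun p => (ζ p.1 p.2).2 with hS
  have hζS : ∀ i w, (ζ i w).2 ∈ S := fun i w =>
    Finset.mem_image.2 ⟨(i, w), Finset.mem_univ _, rfl⟩
  obtain ⟨ν, hν⟩ := Set.countable_iff_exists_injOn.1 S.countable_toSet
  -- In the index, `k` keeps different models apart, `ν s` separates the tails, and `n₀` makes the
  -- index large enough for `F` to contain every `Γ`-letter used.
  obtain ⟨γ, B, hBm, hBpos, hB⟩ := exists_smul_mem_of_finset (μ := μ) (Γ := Γ) S
    (fun s => A (Nat.pair k (n₀ + ν s))) (fun _ => hA_meas _) (fun _ => hA_pos _) huniv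
  refine ⟨m, T.card, fun i w => (ζ i w).1 * γ (ζ i w).2,
    fun i w => (Nat.pair k (n₀ + ν (ζ i w).2), (ζ i w).1), B, hBm, hBpos, ?_, ?_, ?_⟩
  · refine fun i w => ⟨by simp, ?_, fun b hb => ?_⟩
    · exact hF_mono ((Nat.le_add_right _ _).trans (Nat.right_le_pair _ _)) (hn₀ i w)
    · rw [mul_smul]
      exact Set.smul_mem_smul_set (hB _ (hζS i w) b hb)
  · intro i w i' w' h
    simp only [Prod.mk.injEq, Nat.pair_eq_pair, true_and, Nat.add_left_cancel_iff] at h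
    exact ζ_inj _ _ _ _ (Prod.ext h.2 (hν (hζS i w) (hζS i' w') h.1))
  · intro β b hβ hinj
    -- `Φ` is `Γ`-equivariant for any `γ`; equivariance under `Λ` is available only on the saturated
    -- finite set, which suffices by `hQ`.
    let Φ : Γ × AlternatingWord (1 : Γ) (o m) false → X := fun z => (z.1 * γ z.2) • b
    refine ⟨γ z₀.2, fun f hf hfix => ?_⟩
    have hΦ₀ : Φ z₀ = γ z₀.2 • b := by simp [Φ, hz₀]
    have hz₀V : z₀ ∈ V := Finset.mem_insert_self _ _
    have hfV : ∀ z ∈ insert (inducedAction (leftWordAction Γ (o m)) (rightWordAction Γ Λ (o m)) f z₀)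
        (Q f), z ∈ V := fun z hz => Finset.mem_insert_of_mem (Finset.mem_biUnion.2 ⟨f, hf, hz⟩)
    have h := hQ f (MulAction.toPermHom Γ X) β Φ
      (fun a z => by simp [Φ, leftWordAction, prodFstPerm, mul_smul]) (fun l z hz => by
        obtain ⟨i, w, rfl⟩ := ζ_surj z (hfV z (Finset.mem_insert_of_mem hz))
        rw [ζ_smul]
        exact (hβ l i w).symm)
    rw [hΦ₀, hfix, ← hΦ₀] at h
    obtain ⟨i, w, hi⟩ := ζ_surj _ (hfV _ (Finset.mem_insert_self _ _))
    obtain ⟨i', w', hi'⟩ := ζ_surj _ hz₀V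
    rw [← hi, ← hi'] at h
    obtain ⟨rfl, rfl⟩ := hinj i w i' w' h
    exact hm f hf (hi.symm.trans hi')

/-! ### Assembling the models for all finite sets -/

theorem theorem4p5
    {X : Type*} [MeasurableSpace X] [StandardBorelSpace X]
    (μ : Measure X) [IsProbabilityMeasure μ]
    {Γ : Type*} [Group Γ] [Countable Γ]
    [MulAction Γ X] [MeasurableConstSMul Γ X] [ErgodicSMul Γ X μ]
    (hΓ : AEHighlyFaithful (MulAction.toPermHom Γ X) μ)
    {Λ : Type*} [Group Λ] [Countable Λ] [Group.ResiduallyFinite Λ]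
    (F : ℕ → Finset Γ) (hF_mono : Monotone F) (hF_exh : ∀ γ : Γ, ∃ n, γ ∈ F n)
    (hF_one : (1 : Γ) ∈ F 0)
    (A : ℕ → Set X) (hA_meas : ∀ n, MeasurableSet (A n)) (hA_pos : ∀ n, 0 < μ (A n))
    (hA_disj : Set.Pairwise {p : ℕ × Γ | p.2 ∈ F p.1}
      fun p q => AEDisjoint μ (p.2 • A p.1) (q.2 • A q.1))
    {Y : ℕ → Type*} [∀ m, Finite (Y m)] [∀ m, MulAction Λ (Y m)] (o : ∀ m, Y m)
    (ho : AsymptoticallyFree Λ o) :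
    ∃ β : Λ →* Equiv.Perm X,
      IsPMPAction β μ ∧
      (∀ (l : Λ) (x : X), β l x ∈ MulAction.orbit Γ x) ∧
      AEHighlyFaithful (inducedAction (MulAction.toPermHom Γ X) β) μ ∧
      (∀ x ∉ translatesUnion F A, ∀ l : Λ, β l x = x) ∧
      (∀ x : X, (orbitOf β x).Finite) ∧
      (∀ x : X, (∀ l : Λ, β l x = x) ∨ ∃ n : ℕ, OrbitConjugate β x (o n)) ∧
      (∀ β' : Λ →* Equiv.Perm X, IsPMPAction β' μ →
        (∀ᵐ x ∂μ, x ∈ translatesUnion F A → ∀ l : Λ, β' l x = β l x) →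
        AEHighlyFaithful (inducedAction (MulAction.toPermHom Γ X) β') μ) := by
  classical
  let K := {E : Finset (Γ ∗ Λ) // 1 ∉ E}
  obtain ⟨κ, hκ⟩ := exists_injective_nat K
  -- Passing to the orbits of the base points makes the model `Λ`-sets transitive, so each copy is a
  -- single orbit of the required type.
  have ho' : AsymptoticallyFree Λ fun m =>
      (⟨o m, MulAction.mem_orbit_self _⟩ : MulAction.orbit Λ (o m)) := fun g hg =>
    (ho g hg).imp fun n hn m hm h => hn m hm (congrArg Subtype.val h)
  choose m c δ ix B hBm hBpos hix hix_inj hmove using fun E : K =>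
    exists_translates_model μ (by simp) F hF_mono hF_exh A hA_meas hA_pos _ ho' (κ E) E.1 E.2
  -- Outside the null set `D`, disjointness holds exactly at every `Γ`-translate of the point;
  -- removing `D` from each `B E` makes the pieces truly disjoint.
  obtain ⟨D, hD, hDm, hD0⟩ := exists_measurable_superset_of_null (μ := μ)
    (s := {x | ¬ ∀ (γ : Γ) (p q : ℕ × Γ), p.2 ∈ F p.1 → q.2 ∈ F q.1 →
      γ • x ∈ p.2 • A p.1 → γ • x ∈ q.2 • A q.1 → p = q}) (by
    rw [← ae_iff]
    simp only [ae_all_iff]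
    intro γ p q hp hq
    rw [ae_iff]
    by_cases hpq : p = q
    · simp [hpq]
    · refine measure_mono_null ?_ (measure_preimage_smul_null (hA_disj hp hq hpq) γ)
      intro x hx
      simpa [hpq] using hx)
  have hgood : ∀ x, x ∉ D → ∀ (γ : Γ) (p q : ℕ × Γ), p.2 ∈ F p.1 → q.2 ∈ F q.1 →
      γ • x ∈ p.2 • A p.1 → γ • x ∈ q.2 • A q.1 → p = q := fun x hx =>
    not_not.1 fun h => hx (hD h)
  let P := Σ q : (Σ E : K, Fin (c E)), MulAction.orbit Λ (o (m q.1))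
  let δ' : P → Γ := fun p => δ p.1.1 p.1.2 p.2
  let B' : K → Set X := fun E => B E \ D
  have hpiece : ∀ (E : K) i w, ∀ b ∈ B' E, δ E i w • b ∈ (ix E i w).2 • A (ix E i w).1 :=
    fun E i w b hb => (hix E i w).2.2 b hb.1
  have hdisj : ∀ (p q : P) x, x ∈ δ' p • B' p.1.1 → x ∈ δ' q • B' q.1.1 → p = q := by
    rintro ⟨⟨E, i⟩, w⟩ ⟨⟨E', i'⟩, w'⟩ _ ⟨b, hb, rfl⟩ ⟨b', hb', hbb'⟩
    have h := hgood b hb.2 (δ E i w) (ix E i w) (ix E' i' w') (hix E i w).2.1 (hix E' i' w').2.1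
      (hpiece E i w b hb) (by
        have := hpiece E' i' w' b' hb'
        rwa [show δ E' i' w' • b' = δ E i w • b from hbb'] at this)
    -- The first coordinate of the unpaired index is `κ E`, which recovers `E`.
    obtain rfl : E = E' := hκ (by rw [← (hix E i w).1, ← (hix E' i' w').1, h])
    obtain ⟨rfl, rfl⟩ := hix_inj E _ _ _ _ h
    rfl
  obtain ⟨β, hβ_pmp, hβ_orbit, hβ, hβ_fix⟩ := exists_piecewise_action (Λ := Λ) μ δ'
    (fun p => B' p.1.1) (fun p => (hBm _).diff hDm) (fun _ _ => rfl) hdisj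
  have hU : ∀ (p : P) x, x ∈ δ' p • B' p.1.1 → x ∈ translatesUnion F A := by
    rintro ⟨⟨E, i⟩, w⟩ _ ⟨b, hb, rfl⟩
    exact Set.mem_iUnion.2 ⟨_, Set.mem_iUnion₂.2 ⟨_, (hix E i w).2.1, hpiece E i w b hb⟩⟩
  have cases_x : ∀ x, (∀ l, β l x = x) ∨
      ∃ (q : Σ E : K, Fin (c E)) (w : _) (b : _), b ∈ B' q.1 ∧ x = δ' ⟨q, w⟩ • b := by
    intro x
    by_cases h : ∃ p, x ∈ δ' p • B' p.1.1
    · obtain ⟨⟨q, w⟩, b, hb, rfl⟩ := h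
      exact Or.inr ⟨q, w, b, hb, rfl⟩
    · exact Or.inl (hβ_fix x (by simpa using h))
  have hβ' : ∀ (l : Λ) (q : Σ E : K, Fin (c E)) (w : MulAction.orbit Λ (o (m q.1))),
      ∀ b ∈ B' q.1, β l (δ' ⟨q, w⟩ • b) = δ' ⟨q, l • w⟩ • b :=
    fun l q w b hb => hβ l ⟨q, w⟩ b hb
  -- The models lie inside `translatesUnion F A`, so agreement with `β` there is all that is needed;
  -- `β' = β` is a special case.
  have hfaithful : ∀ β' : Λ →* Equiv.Perm X,
      (∀ᵐ x ∂μ, x ∈ translatesUnion F A → ∀ l : Λ, β' l x = β l x) →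
      AEHighlyFaithful (inducedAction (MulAction.toPermHom Γ X) β') μ := by
    intro β' hagree
    have h1 : ∀ᵐ x ∂μ, ∀ γ : Γ, γ • x ∈ translatesUnion F A →
        ∀ l : Λ, β' l (γ • x) = β l (γ • x) :=
      ae_all_iff.2 fun γ => (measurePreserving_smul γ μ).quasiMeasurePreserving.ae hagree
    have h2 : ∀ᵐ x ∂μ, ∀ E : K, ∃ γ : Γ, γ • x ∈ B' E :=
      ae_all_iff.2 fun E => ae_exists_smul_mem _ ((hBm E).diff hDm)
        (by rw [measure_sdiff_null hD0]; exact hBpos E)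
    filter_upwards [h1, h2] with x hx1 hx2 E hE
    obtain ⟨γ, hγ⟩ := hx2 ⟨E, hE⟩
    obtain ⟨g, hg⟩ := hmove ⟨E, hE⟩ β' (γ • x)
      (fun l i w => by
        have hmem : δ ⟨E, hE⟩ i w • γ • x ∈ translatesUnion F A :=
          hU ⟨⟨⟨E, hE⟩, i⟩, w⟩ _ (Set.smul_mem_smul_set hγ)
        rw [← mul_smul] at hmem ⊢
        rw [hx1 _ hmem, mul_smul]
        exact hβ' l ⟨⟨E, hE⟩, i⟩ w _ hγ)
      (fun i w i' w' h => by
        have h' := hdisj ⟨⟨⟨E, hE⟩, i⟩, w⟩ ⟨⟨⟨E, hE⟩, i'⟩, w'⟩ _ (Set.smul_mem_smul_set hγ)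
          (by rw [show δ' ⟨⟨⟨E, hE⟩, i⟩, w⟩ • γ • x = δ' ⟨⟨⟨E, hE⟩, i'⟩, w'⟩ • γ • x from h]
              exact Set.smul_mem_smul_set hγ)
        cases h'
        exact ⟨rfl, rfl⟩)
    exact ⟨g • γ • x, ⟨.inl (g * γ), by simp [inducedAction]⟩, hg⟩
  refine ⟨β, hβ_pmp, hβ_orbit, hfaithful β (.of_forall fun _ _ _ => rfl),
    fun x hx => hβ_fix x fun p hp => hx (hU p x hp), ?_, ?_, fun β' _ => hfaithful β'⟩
  · intro x
    rcases cases_x x with h | ⟨q, w, b, hb, rfl⟩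
    · refine (Set.finite_singleton x).subset ?_
      rintro _ ⟨l, rfl⟩
      exact h l
    · refine (Set.finite_range fun w => δ' ⟨q, w⟩ • b).subset ?_
      rintro _ ⟨l, rfl⟩
      exact ⟨l • w, (hβ' l q w b hb).symm⟩
  · intro x
    rcases cases_x x with h | ⟨q, w, b, hb, rfl⟩
    · exact Or.inl h
    · refine Or.inr ⟨m q.1, Equiv.ofBijective (fun z => ⟨δ' ⟨q, z⟩ • b, ?_⟩) ⟨?_, ?_⟩, ?_⟩
      · obtain ⟨l, rfl⟩ := MulAction.exists_smul_eq Λ w z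
        exact ⟨l, hβ' l q w b hb⟩
      · intro z z' h
        have h' := hdisj ⟨q, z⟩ ⟨q, z'⟩ _ (Set.smul_mem_smul_set hb)
          (by rw [show δ' ⟨q, z⟩ • b = δ' ⟨q, z'⟩ • b from congrArg Subtype.val h]
              exact Set.smul_mem_smul_set hb)
        cases h'
        rfl
      · rintro ⟨_, l, rfl⟩
        exact ⟨l • w, Subtype.ext (hβ' l q w b hb).symm⟩
      · intro l z
        exact (hβ' l q z b hb).symm
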